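/- Let $\varepsilon=1$ or $\varepsilon=-1$ and let $R^3_+=\{(x_1,x_2,x_3)\in\mathbb R^3: x_3>0\}$ carry the metric $$ds^2=\frac{dx_1^2+dx_2^2+\varepsilon\,dx_3^2}{x_3^2},$$ so that $R^3_+$ is the upper half-space model of the hyperbolic space $H^3$ for $\varepsilon=1$ and of the de Sitter space $S^3_1$ for $\varepsilon=-1$. The space $R^3_+$ is a Lie group with multiplication $(a_1,a_2,a_3)(b_1,b_2,b_3)=(a_3b_1+a_1,\;a_3b_2+a_2,\;a_3b_3)$ and identity $e=(0,0,1)$, and $ds^2$ is left-invariant. Let $M$ be a smooth $2$-dimensional manifold and let $x:M\to R^3_+$ be a smooth immersion whose induced metric $\mathrm I$ is positive definite (this is automatic for $\varepsilon=1$, and says that the surface is space-like for $\varepsilon=-1$). Let $N$ be a smooth unit normal vector field along $x$, i.e. $\langle N,N\rangle=\varepsilon$ and $\langle N,dx(v)\rangle=0$ for all tangent vectors $v$ of $M$. Let $\mathrm{II}(v,w)=-\varepsilon\langle\nabla_vN,dx(w)\rangle$ be the second fundamental form, where $\nabla$ is the Levi-Civita connection of $ds^2$. The normal Gauss map is $$\widetilde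 N=L_{x^{-1}*}(N)=\eta_1\tfrac{\partial}{\partial x_1}(e)+\eta_2\tfrac{\partial}{\partial x_2}(e)+\eta_3\tfrac{\partial}{\partial x_3}(e),$$ where $L_{x^{-1}}$ is left translation by the inverse of $x$, and the fourth fundamental form is $\mathrm{IV}=d\eta_1^2+d\eta_2^2+\varepsilon\,d\eta_3^2$. The normal Gauss map is called conformal if $\mathrm{IV}=\rho\,\mathrm{II}$ for some smooth function $\rho:M\to\mathbb R$. A point of $M$ is an umbilic if $\mathrm{II}=c\,\mathrm I$ there for some $c\in\mathbb R$. THEOREM 3.3. Suppose that the surface has no umbilics, and let $K$ be the Gauss curvature of $\mathrm I$. If $\varepsilon=1$ (surfaces in $H^3$), the normal Gauss map is conformal if and only if $K=-1+\eta_3^2$ on $M$. If $\varepsilon=-1$ (space-like surfaces in $S^3_1$), the normal Gauss map is conformal if and only if $K=1-\eta_3^2$ on $M$. -/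

import Mathlib

open scoped Manifold ContDiff

noncomputable section

namespace NormalGauss

/-- The coordinate space of dimension `n`. -/
abbrev E (n : ℕ) : Type := EuclideanSpace ℝ (Fin n)

/-! ### (Pseudo-)Riemannian metrics in coordinates -/

/-- The partial derivative `∂f/∂uᵢ` at `u`. -/
def pd {n : ℕ} (i : Fin n) (f : E n → ℝ) (u : E n) : ℝ :=
  fderiv ℝ f u (EuclideanSpace.single i 1)

/-- Christoffel symbols of the Levi-Civita connection of the metric `g = (gᵢⱼ)`:
`Γᵏᵢⱼ = ½ ∑ₗ gᵏˡ (∂ᵢ gⱼₗ + ∂ⱼ gᵢₗ - ∂ₗ gᵢⱼ)`. -/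
def christoffel {n : ℕ} (g : E n → Matrix (Fin n) (Fin n) ℝ) (k i j : Fin n) (u : E n) : ℝ :=
  (1 / 2 : ℝ) * ∑ l, (g u)⁻¹ k l *
    (pd i (fun y => g y j l) u + pd j (fun y => g y i l) u - pd l (fun y => g y i j) u)

/-- Riemann curvature tensor: `R(∂ᵢ, ∂ⱼ) ∂ₖ = ∑ₗ (riemann g l k i j) ∂ₗ`, where
`R(X, Y) Z = ∇_X ∇_Y Z - ∇_Y ∇_X Z - ∇_{[X, Y]} Z`. -/
def riemann {n : ℕ} (g : E n → Matrix (Fin n) (Fin n) ℝ) (l k i j : Fin n) (u : E n) : ℝ :=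
  pd i (christoffel g l j k) u - pd j (christoffel g l i k) u
    + ∑ m, (christoffel g l i m u * christoffel g m j k u
      - christoffel g l j m u * christoffel g m i k u)

/-- Gauss curvature of a two-dimensional metric:
`⟨R(∂₁, ∂₂) ∂₂, ∂₁⟩ / (g₁₁ g₂₂ - g₁₂²)`. -/
def coordGaussCurvature (g : E 2 → Matrix (Fin 2) (Fin 2) ℝ) (u : E 2) : ℝ :=
  (∑ l, g u 0 l * riemann g l 1 0 1 u) / (g u).det

/-! ### The two ambient spaces

Both are the upper half-space `{y ∈ ℝ³ | y₃ > 0}`; the sign `ε` is `1` for `H³` and `-1`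
for `S₁³`. Coordinates `1, 2, 3` are the indices `0, 1, 2`. -/

/-- The scalar product `a₁ b₁ + a₂ b₂ + ε a₃ b₃` of `ℝ³`
(Euclidean for `ε = 1`, Lorentz-Minkowski for `ε = -1`). -/
def flatForm (ε : ℝ) (a b : E 3) : ℝ := a 0 * b 0 + a 1 * b 1 + ε * (a 2 * b 2)

/-- The metric `(dy₁² + dy₂² + ε dy₃²) / y₃²` evaluated on two tangent vectors at `y`. -/
def ambientForm (ε : ℝ) (y a b : E 3) : ℝ := flatForm ε a b / (y 2) ^ 2

/-- The matrix of `ambientForm` in the coordinate frame. -/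
def ambientMatrix (ε : ℝ) (y : E 3) : Matrix (Fin 3) (Fin 3) ℝ :=
  Matrix.of fun i j => ambientForm ε y (EuclideanSpace.single i 1) (EuclideanSpace.single j 1)

/-! ### The Lie group structure of the upper half-space -/

/-- The identification of the upper half-space with a group of matrices. -/
def groupMatrix (a : E 3) : Matrix (Fin 4) (Fin 4) ℝ :=
  !![1, 0, 0, Real.log (a 2);
     0, a 2, 0, a 0;
     0, 0, a 2, a 1;
     0, 0, 0, 1]

/-- The multiplication of the group, in coordinates. -/
def groupMul (a b : E 3) : E 3 := !₂[a 2 * b 0 + a 0, a 2 * b 1 + a 1, a 2 * b 2]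

/-- The inverse in the group, in coordinates. -/
def groupInv (a : E 3) : E 3 := !₂[-(a 0 / a 2), -(a 1 / a 2), 1 / a 2]

/-- `groupMul` is matrix multiplication. -/
theorem groupMatrix_mul (a b : E 3) (ha : 0 < a 2) (hb : 0 < b 2) :
    groupMatrix (groupMul a b) = groupMatrix a * groupMatrix b := by
  ext i j
  fin_cases i <;> fin_cases j <;>
    simp [groupMatrix, groupMul, Matrix.mul_apply, Fin.sum_univ_four,
      Real.log_mul ha.ne' hb.ne', add_comm]

/-- `groupInv` is the inverse for `groupMul`, with identity `(0, 0, 1)`. -/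
theorem groupInv_mul (a : E 3) (ha : 0 < a 2) : groupMul (groupInv a) a = !₂[0, 0, 1] := by
  have h := ha.ne'
  ext i
  fin_cases i <;> simp [groupMul, groupInv] <;> field_simp <;> ring

/-! ### Surfaces -/

section Surface

variable {M : Type*} [TopologicalSpace M] [ChartedSpace (E 2) M]

/-- The differential at `p` of a map from `M` to coordinate space. -/
def diff (f : M → E 3) (p : M) : TangentSpace (𝓡 2) p →L[ℝ] E 3 :=
  mfderiv (𝓡 2) 𝓘(ℝ, E 3) f p

/-- `x` is a smooth immersion of `M` into the upper half-space such that the metric induced by the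
ambient metric is positive definite, i.e. an immersed surface in `H³` for `ε = 1` (where
definiteness is automatic) and an immersed space-like surface in `S₁³` for `ε = -1`; `N` (given by
its components in the frame `∂/∂y₁, ∂/∂y₂, ∂/∂y₃` along `x`) is a smooth unit normal field,
`⟨N, N⟩ = ε`. -/
structure IsSurface (ε : ℝ) (x N : M → E 3) : Prop where
  smooth : ContMDiff (𝓡 2) 𝓘(ℝ, E 3) ∞ x
  pos : ∀ p, 0 < x p 2
  immersion : ∀ p, Function.Injective (diff x p)
  spacelike : ∀ p v, v ≠ 0 → 0 < ambientForm ε (x p) (diff x p v) (diff x p v)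
  normal_smooth : ContMDiff (𝓡 2) 𝓘(ℝ, E 3) ∞ N
  normal_unit : ∀ p, ambientForm ε (x p) (N p) (N p) = ε
  normal_orthogonal : ∀ p v, ambientForm ε (x p) (N p) (diff x p v) = 0

/-- For `ε = 1` the field `spacelike` follows from the immersion property. -/
theorem spacelike_of_immersion (x : M → E 3) (pos : ∀ p, 0 < x p 2)
    (immersion : ∀ p, Function.Injective (diff x p)) (p : M) (v : TangentSpace (𝓡 2) p)
    (hv : v ≠ 0) : 0 < ambientForm 1 (x p) (diff x p v) (diff x p v) := by
  have h0 : diff x p v ≠ 0 := fun h => hv (immersion p (by rw [h, map_zero]))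
  unfold ambientForm flatForm
  refine div_pos ?_ (pow_pos (pos p) 2)
  set w := diff x p v
  have hw : 0 < w 0 * w 0 + w 1 * w 1 + w 2 * w 2 := by
    by_contra hc
    refine h0 ?_
    have h0' := mul_self_nonneg (w 0)
    have h1' := mul_self_nonneg (w 1)
    have h2' := mul_self_nonneg (w 2)
    ext i
    fin_cases i
    · exact mul_self_eq_zero.mp (by simp only [Fin.zero_eta] at *; linarith)
    · exact mul_self_eq_zero.mp (by simp only [Fin.mk_one] at *; linarith)
    · exact mul_self_eq_zero.mp (by simp only [Fin.reduceFinMk] at *; linarith)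
  linarith

/-- First fundamental form (the induced metric). -/
def firstForm (ε : ℝ) (x : M → E 3) (p : M) (v w : TangentSpace (𝓡 2) p) : ℝ :=
  ambientForm ε (x p) (diff x p v) (diff x p w)

/-- The ambient covariant derivative `∇_v N` of the vector field `N` along `x`. -/
def covDeriv (ε : ℝ) (x N : M → E 3) (p : M) (v : TangentSpace (𝓡 2) p) : E 3 :=
  WithLp.toLp 2 fun k => diff N p v k
    + ∑ i, ∑ j, christoffel (ambientMatrix ε) k i j (x p) * diff x p v i * N p j

/-- Second fundamental form `II(v, w) = -ε ⟨∇_v N, dx(w)⟩`. As `⟨N, N⟩ = ε`, this is the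
coefficient of `N` in the normal part of `∇_v dx(W)`, `W` a tangent field extending `w`. -/
def secondForm (ε : ℝ) (x N : M → E 3) (p : M) (v w : TangentSpace (𝓡 2) p) : ℝ :=
  -ε * ambientForm ε (x p) (covDeriv ε x N p v) (diff x p w)

/-- `p` is an umbilic: the second fundamental form is a multiple of the first at `p`. -/
def IsUmbilic (ε : ℝ) (x N : M → E 3) (p : M) : Prop :=
  ∃ c : ℝ, ∀ v w : TangentSpace (𝓡 2) p, secondForm ε x N p v w = c * firstForm ε x p v w

/-- The normal Gauss map: `N` at `x p`, left translated to the tangent space at the identity.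
Its components are `η₁, η₂, η₃`. -/
def normalGaussMap (x N : M → E 3) (p : M) : E 3 :=
  fderiv ℝ (groupMul (groupInv (x p))) (x p) (N p)

/-- Fourth fundamental form: the pull-back of the flat scalar product by the normal Gauss map. -/
def fourthForm (ε : ℝ) (x N : M → E 3) (p : M) (v w : TangentSpace (𝓡 2) p) : ℝ :=
  flatForm ε (diff (normalGaussMap x N) p v) (diff (normalGaussMap x N) p w)

/-- The normal Gauss map is conformal: `IV = ρ II` for a smooth function `ρ` on `M`. -/
def IsConformalNormalGauss (ε : ℝ) (x N : M → E 3) : Prop :=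
  ∃ ρ : M → ℝ, ContMDiff (𝓡 2) 𝓘(ℝ, ℝ) ∞ ρ ∧
    ∀ (p : M) (v w : TangentSpace (𝓡 2) p),
      fourthForm ε x N p v w = ρ p * secondForm ε x N p v w

/-- The matrix `(gᵢⱼ)` of the induced metric in the chart of `M` at `p`, as a function of the
coordinates `u`. -/
def chartMetric (ε : ℝ) (x : M → E 3) (p : M) (u : E 2) : Matrix (Fin 2) (Fin 2) ℝ :=
  Matrix.of fun i j =>
    ambientForm ε (x ((extChartAt (𝓡 2) p).symm u))
      (fderiv ℝ (x ∘ (extChartAt (𝓡 2) p).symm) u (EuclideanSpace.single i 1))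
      (fderiv ℝ (x ∘ (extChartAt (𝓡 2) p).symm) u (EuclideanSpace.single j 1))

/-- Gauss curvature at `p` of the induced metric. -/
def gaussCurvature (ε : ℝ) (x : M → E 3) (p : M) : ℝ :=
  coordGaussCurvature (chartMetric ε x p) (extChartAt (𝓡 2) p p)

end Surface

end NormalGauss

end

noncomputable section

namespace NormalGauss

/-! ### The scalar product of `ℝ³` -/

/-! Translate everything to the identity of the group. Let `t(v) = dx(v)/x₃` and `η = N/x₃`; both
live in the flat space with form `flatForm`, and `I = ⟨t, t⟩`. The derivative `dη(v)` is orthogonal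
to `η` because `⟨η, η⟩ = ε`, and the translate of `∇_v N` is `dη(v) - η₃ t(v)`
(`IsSurface.covDeriv_eq`). Writing `t(Bv)` for this translate gives `dη = t ∘ (B + η₃)` and `II = -ε
I(B·, ·)`.

Hence `IV = I((B + η₃)·, (B + η₃)·)`, and Cayley–Hamilton, `B² = (tr B) B - det B`, yields `IV =
(η₃² - det B) I + τ II` with `τ = -ε (tr B + 2η₃)` (`fourth_eq_algebra`). The ambient space has
constant curvature `-ε`, so the Gauss equation reads `K = -ε + ε det B`, that is `det B = 1 + εK`
(`gauss_equation`). Together these give `IsSurface.fourthForm_eq`.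

Away from umbilics `II` is not a multiple of `I`, so `IV = ρ II` holds exactly when `ρ = τ` and `η₃²
= 1 + εK`. In the converse direction `ρ` is smooth because it is locally a quotient of coefficients
of `IV` and `II`, the latter nonvanishing. -/

theorem flatForm_comm (ε : ℝ) (a b : E 3) : flatForm ε a b = flatForm ε b a := by
  unfold flatForm; ring

theorem flatForm_add_left (ε : ℝ) (a b c : E 3) :
    flatForm ε (a + b) c = flatForm ε a c + flatForm ε b c := by
  simp only [flatForm, PiLp.add_apply]; ring

theorem flatForm_smul_left (ε r : ℝ) (a b : E 3) :
    flatForm ε (r • a) b = r * flatForm ε a b := by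
  simp only [flatForm, PiLp.smul_apply, smul_eq_mul]; ring

theorem flatForm_add_right (ε : ℝ) (a b c : E 3) :
    flatForm ε a (b + c) = flatForm ε a b + flatForm ε a c := by
  simp only [flatForm, PiLp.add_apply]; ring

theorem flatForm_smul_right (ε r : ℝ) (a b : E 3) :
    flatForm ε a (r • b) = r * flatForm ε a b := by
  simp only [flatForm, PiLp.smul_apply, smul_eq_mul]; ring

theorem flatForm_sub_left (ε : ℝ) (a b c : E 3) :
    flatForm ε (a - b) c = flatForm ε a c - flatForm ε b c := by
  simp only [flatForm, PiLp.sub_apply]; ring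

/-- Expansion of the scalar product in a basis consisting of two vectors and a common unit
normal. -/
theorem flatForm_expand {ε : ℝ} (hε : ε * ε = 1) {t₀ t₁ m : E 3}
    (hm : flatForm ε m m = ε) (h₀ : flatForm ε m t₀ = 0) (h₁ : flatForm ε m t₁ = 0)
    (hD : flatForm ε t₀ t₀ * flatForm ε t₁ t₁ - flatForm ε t₀ t₁ ^ 2 ≠ 0) (a b : E 3) :
    (flatForm ε t₀ t₀ * flatForm ε t₁ t₁ - flatForm ε t₀ t₁ ^ 2) *
        (flatForm ε a b - ε * (flatForm ε a m * flatForm ε b m)) =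
      flatForm ε t₁ t₁ * (flatForm ε a t₀ * flatForm ε b t₀)
        - flatForm ε t₀ t₁ * (flatForm ε a t₀ * flatForm ε b t₁ + flatForm ε a t₁ * flatForm ε b t₀)
        + flatForm ε t₀ t₀ * (flatForm ε a t₁ * flatForm ε b t₁) := by
  set D := flatForm ε t₀ t₀ * flatForm ε t₁ t₁ - flatForm ε t₀ t₁ ^ 2 with hDdef
  let J : Matrix (Fin 3) (Fin 3) ℝ := !![1, 0, 0; 0, 1, 0; 0, 0, ε]
  let Q : Matrix (Fin 3) (Fin 3) ℝ := !![t₀ 0, t₀ 1, t₀ 2; t₁ 0, t₁ 1, t₁ 2; m 0, m 1, m 2]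
  -- `H` is the inverse of the Gram matrix of `t₀, t₁, m`; its last entry is `ε` because `ε⁻¹ = ε`.
  let H : Matrix (Fin 3) (Fin 3) ℝ :=
    !![flatForm ε t₁ t₁ / D, -flatForm ε t₀ t₁ / D, 0;
       -flatForm ε t₀ t₁ / D, flatForm ε t₀ t₀ / D, 0;
       0, 0, ε]
  have hQ : Q * J * Q.transpose = !![flatForm ε t₀ t₀, flatForm ε t₀ t₁, 0;
      flatForm ε t₀ t₁, flatForm ε t₁ t₁, 0; 0, 0, ε] := by
    rw [flatForm_comm] at h₀ h₁
    have h₀' := h₀; have h₁' := h₁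
    rw [flatForm_comm] at h₀' h₁'
    unfold flatForm at *
    ext i j
    fin_cases i <;> fin_cases j <;>
      simp [Q, J, Matrix.mul_apply, Fin.sum_univ_three] <;>
      linarith
  have hG : Q * (J * Q.transpose * H) = 1 := by
    rw [← Matrix.mul_assoc, ← Matrix.mul_assoc, hQ]
    ext i j
    fin_cases i <;> fin_cases j <;>
      simp [H, Matrix.mul_apply, Fin.sum_univ_three, hε] <;>
      field_simp <;> (try rw [hDdef]) <;> ring
  -- A right inverse of a square matrix is a left inverse: this is the completeness relation for the
  -- basis, which inserted between `a` and `b` gives the expansion.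
  have hG' : J * Q.transpose * H * Q = 1 := mul_eq_one_comm.mp hG
  have key : flatForm ε a b =
      (![a 0, a 1, a 2] : Fin 3 → ℝ) ⬝ᵥ ((J * Q.transpose * H * Q * J).mulVec ![b 0, b 1, b 2]) := by
    rw [hG', Matrix.one_mul]
    simp [J, flatForm, Matrix.mulVec, dotProduct, Fin.sum_univ_three]
    ring
  have e₁ : (Q * J).mulVec ![b 0, b 1, b 2] = ![flatForm ε b t₀, flatForm ε b t₁, flatForm ε b m] := by
    ext i
    fin_cases i <;>
      simp [Q, J, flatForm, Matrix.mulVec, dotProduct, Fin.sum_univ_three, Matrix.mul_apply] <;> ring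
  have e₂ : Matrix.vecMul ![a 0, a 1, a 2] (J * Q.transpose) =
      ![flatForm ε a t₀, flatForm ε a t₁, flatForm ε a m] := by
    ext i
    fin_cases i <;>
      simp [Q, J, flatForm, Matrix.vecMul, dotProduct, Fin.sum_univ_three, Matrix.mul_apply] <;> ring
  rw [Matrix.mul_assoc, ← Matrix.mulVec_mulVec, e₁, Matrix.dotProduct_mulVec,
    ← Matrix.vecMul_vecMul, e₂] at key
  rw [key]
  simp [H, Matrix.vecMul, dotProduct, Fin.sum_univ_three]
  field_simp
  ring

/-- The pointwise algebra relating the three fundamental forms: `t₀, t₁` is the left-translated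
tangent frame, `m` the left-translated normal and `s₀, s₁` its derivatives. -/
theorem fourth_eq_algebra {ε : ℝ} (hε : ε * ε = 1) {t₀ t₁ m s₀ s₁ : E 3}
    (hm : flatForm ε m m = ε) (h₀ : flatForm ε m t₀ = 0) (h₁ : flatForm ε m t₁ = 0)
    (hs₀ : flatForm ε s₀ m = 0) (hs₁ : flatForm ε s₁ m = 0)
    (hsymm : flatForm ε s₀ t₁ = flatForm ε s₁ t₀)
    (hD : flatForm ε t₀ t₀ * flatForm ε t₁ t₁ - flatForm ε t₀ t₁ ^ 2 ≠ 0) (r : ℝ) :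
    ∃ τ : ℝ, ∀ v₀ v₁ w₀ w₁ : ℝ,
      flatForm ε (v₀ • s₀ + v₁ • s₁) (w₀ • s₀ + w₁ • s₁) =
        (r ^ 2 - ((flatForm ε s₀ t₀ - r * flatForm ε t₀ t₀) *
              (flatForm ε s₁ t₁ - r * flatForm ε t₁ t₁)
            - (flatForm ε s₀ t₁ - r * flatForm ε t₀ t₁) ^ 2) /
              (flatForm ε t₀ t₀ * flatForm ε t₁ t₁ - flatForm ε t₀ t₁ ^ 2)) *
          flatForm ε (v₀ • t₀ + v₁ • t₁) (w₀ • t₀ + w₁ • t₁) +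
        τ * (-ε * (flatForm ε (v₀ • s₀ + v₁ • s₁) (w₀ • t₀ + w₁ • t₁) -
            r * flatForm ε (v₀ • t₀ + v₁ • t₁) (w₀ • t₀ + w₁ • t₁))) := by
  have k₀₀ := flatForm_expand hε hm h₀ h₁ hD s₀ s₀
  have k₀₁ := flatForm_expand hε hm h₀ h₁ hD s₀ s₁
  have k₁₁ := flatForm_expand hε hm h₀ h₁ hD s₁ s₁
  simp only [hs₀, hs₁] at k₀₀ k₀₁ k₁₁
  -- `τ = -ε tr B - 2εr`, where `B` has matrix `g⁻¹(⟨sᵢ, tⱼ⟩ - r gᵢⱼ)`: the terms of `(B + r)²`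
  -- linear in `B` after Cayley–Hamilton. The quotient subtracted from `r²` is `det B`.
  refine ⟨-ε * (flatForm ε t₁ t₁ * (flatForm ε s₀ t₀ - r * flatForm ε t₀ t₀)
      - 2 * flatForm ε t₀ t₁ * (flatForm ε s₀ t₁ - r * flatForm ε t₀ t₁)
      + flatForm ε t₀ t₀ * (flatForm ε s₁ t₁ - r * flatForm ε t₁ t₁)) /
        (flatForm ε t₀ t₀ * flatForm ε t₁ t₁ - flatForm ε t₀ t₁ ^ 2) - 2 * ε * r,
    fun v₀ v₁ w₀ w₁ => ?_⟩
  simp only [flatForm_add_left, flatForm_smul_left, flatForm_add_right,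
    flatForm_smul_right, flatForm_comm ε s₁ s₀, flatForm_comm ε t₁ t₀, ← hsymm]
  rw [← hsymm] at k₀₁ k₁₁
  generalize flatForm ε t₀ t₀ = g₀₀ at *
  generalize flatForm ε t₀ t₁ = g₀₁ at *
  generalize flatForm ε t₁ t₁ = g₁₁ at *
  generalize flatForm ε s₀ t₀ = a₀₀ at *
  generalize flatForm ε s₀ t₁ = a₀₁ at *
  generalize flatForm ε s₁ t₁ = a₁₁ at *
  generalize flatForm ε s₀ s₀ = f₀₀ at *
  generalize flatForm ε s₀ s₁ = f₀₁ at *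
  generalize flatForm ε s₁ s₁ = f₁₁ at *
  apply mul_left_cancel₀ hD
  generalize hK : (_ - _ ^ 2) / (g₀₀ * g₁₁ - g₀₁ ^ 2) = K
  generalize hτ : -ε * _ / (g₀₀ * g₁₁ - g₀₁ ^ 2) = τ
  rw [div_eq_iff hD] at hK hτ
  have : ε = 1 ∨ ε = -1 := mul_self_eq_one_iff.mp hε
  rcases this with rfl | rfl
  · linear_combination v₀ * w₀ * k₀₀ + (v₀ * w₁ + v₁ * w₀) * k₀₁ + v₁ * w₁ * k₁₁
      + (w₀ * (v₀ * g₀₀ + v₁ * g₀₁) + w₁ * (v₀ * g₀₁ + v₁ * g₁₁)) * -hK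
      + (-1 * (w₀ * (v₀ * a₀₀ + v₁ * a₀₁) + w₁ * (v₀ * a₀₁ + v₁ * a₁₁) -
          r * (w₀ * (v₀ * g₀₀ + v₁ * g₀₁) + w₁ * (v₀ * g₀₁ + v₁ * g₁₁)))) * hτ
  · linear_combination v₀ * w₀ * k₀₀ + (v₀ * w₁ + v₁ * w₀) * k₀₁ + v₁ * w₁ * k₁₁
      + (w₀ * (v₀ * g₀₀ + v₁ * g₀₁) + w₁ * (v₀ * g₀₁ + v₁ * g₁₁)) * -hK
      + (1 * (w₀ * (v₀ * a₀₀ + v₁ * a₀₁) + w₁ * (v₀ * a₀₁ + v₁ * a₁₁) -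
          r * (w₀ * (v₀ * g₀₀ + v₁ * g₀₁) + w₁ * (v₀ * g₀₁ + v₁ * g₁₁)))) * hτ

/-! ### Partial derivatives -/

/-- Partial derivative of a vector-valued function. -/
def vd {n : ℕ} (i : Fin n) (V : E n → E 3) (u : E n) : E 3 :=
  fderiv ℝ V u (EuclideanSpace.single i 1)

theorem pd_congr {n : ℕ} {f g : E n → ℝ} {U : Set (E n)} (hU : IsOpen U) (h : Set.EqOn f g U)
    {u : E n} (hu : u ∈ U) (i : Fin n) : pd i f u = pd i g u := by
  unfold pd
  rw [(Filter.eventuallyEq_of_mem (hU.mem_nhds hu) h).fderiv_eq]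

theorem pd_add {n : ℕ} {f g : E n → ℝ} {u : E n} (hf : DifferentiableAt ℝ f u)
    (hg : DifferentiableAt ℝ g u) (i : Fin n) :
    pd i (fun y => f y + g y) u = pd i f u + pd i g u := by
  unfold pd
  rw [fderiv_fun_add hf hg]; rfl

theorem pd_mul {n : ℕ} {f g : E n → ℝ} {u : E n} (hf : DifferentiableAt ℝ f u)
    (hg : DifferentiableAt ℝ g u) (i : Fin n) :
    pd i (fun y => f y * g y) u = pd i f u * g u + f u * pd i g u := by
  unfold pd
  rw [fderiv_fun_mul hf hg]
  simp; ring

theorem vd_congr {n : ℕ} {f g : E n → E 3} {U : Set (E n)} (hU : IsOpen U) (h : Set.EqOn f g U)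
    {u : E n} (hu : u ∈ U) (i : Fin n) : vd i f u = vd i g u := by
  unfold vd
  rw [(Filter.eventuallyEq_of_mem (hU.mem_nhds hu) h).fderiv_eq]

theorem vd_add {n : ℕ} {f g : E n → E 3} {u : E n} (hf : DifferentiableAt ℝ f u)
    (hg : DifferentiableAt ℝ g u) (i : Fin n) :
    vd i (fun y => f y + g y) u = vd i f u + vd i g u := by
  unfold vd
  rw [fderiv_fun_add hf hg]; rfl

theorem vd_sub {n : ℕ} {f g : E n → E 3} {u : E n} (hf : DifferentiableAt ℝ f u)
    (hg : DifferentiableAt ℝ g u) (i : Fin n) :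
    vd i (fun y => f y - g y) u = vd i f u - vd i g u := by
  unfold vd
  rw [fderiv_fun_sub hf hg]; rfl

theorem vd_smul {n : ℕ} {f : E n → ℝ} {V : E n → E 3} {u : E n} (hf : DifferentiableAt ℝ f u)
    (hV : DifferentiableAt ℝ V u) (i : Fin n) :
    vd i (fun y => f y • V y) u = pd i f u • V u + f u • vd i V u := by
  unfold vd pd
  rw [fderiv_fun_smul hf hV]
  simp [add_comm]

theorem pd_apply {n : ℕ} {V : E n → E 3} {u : E n} (hV : DifferentiableAt ℝ V u) (i : Fin n)
    (k : Fin 3) : pd i (fun y => V y k) u = vd i V u k := by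
  unfold vd pd
  have := ((EuclideanSpace.proj (𝕜 := ℝ) k).hasFDerivAt.comp u hV.hasFDerivAt).fderiv
  have e : (fun y => V y k) = (EuclideanSpace.proj (𝕜 := ℝ) k : E 3 →L[ℝ] ℝ) ∘ V := rfl
  rw [e, this]; rfl

theorem differentiableAt_apply {n : ℕ} {V : E n → E 3} {u : E n} (hV : DifferentiableAt ℝ V u)
    (k : Fin 3) : DifferentiableAt ℝ (fun y => V y k) u :=
  (EuclideanSpace.proj (𝕜 := ℝ) k : E 3 →L[ℝ] ℝ).differentiableAt.comp u hV

theorem contDiffOn_apply {n : ℕ} {V : E n → E 3} {U : Set (E n)} (hV : ContDiffOn ℝ ∞ V U)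
    (k : Fin 3) : ContDiffOn ℝ ∞ (fun y => V y k) U :=
  (EuclideanSpace.proj (𝕜 := ℝ) k : E 3 →L[ℝ] ℝ).contDiff.comp_contDiffOn hV

theorem contDiffOn_flatForm {n : ℕ} (ε : ℝ) {V W : E n → E 3} {U : Set (E n)}
    (hV : ContDiffOn ℝ ∞ V U) (hW : ContDiffOn ℝ ∞ W U) :
    ContDiffOn ℝ ∞ (fun y => flatForm ε (V y) (W y)) U := by
  unfold flatForm
  exact (((contDiffOn_apply hV 0).mul (contDiffOn_apply hW 0)).add
    ((contDiffOn_apply hV 1).mul (contDiffOn_apply hW 1))).add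
    (contDiffOn_const.mul ((contDiffOn_apply hV 2).mul (contDiffOn_apply hW 2)))

theorem contDiffOn_fderiv_apply {n m : ℕ} {V : E n → E m} {U : Set (E n)} (hU : IsOpen U)
    (hV : ContDiffOn ℝ ∞ V U) (v : E n) : ContDiffOn ℝ ∞ (fun y => fderiv ℝ V y v) U :=
  (hV.fderiv_of_isOpen hU (by simp)).clm_apply contDiffOn_const

theorem contDiffOn_vd {n : ℕ} {V : E n → E 3} {U : Set (E n)} (hU : IsOpen U)
    (hV : ContDiffOn ℝ ∞ V U) (i : Fin n) : ContDiffOn ℝ ∞ (vd i V) U :=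
  contDiffOn_fderiv_apply hU hV _

theorem contDiffOn_pd {n : ℕ} {f : E n → ℝ} {U : Set (E n)} (hU : IsOpen U)
    (hf : ContDiffOn ℝ ∞ f U) (i : Fin n) : ContDiffOn ℝ ∞ (pd i f) U :=
  (hf.fderiv_of_isOpen hU (by simp)).clm_apply contDiffOn_const

theorem differentiableAt_of_contDiffOn {n : ℕ} {F : Type*} [NormedAddCommGroup F] [NormedSpace ℝ F]
    {f : E n → F} {U : Set (E n)} (hU : IsOpen U) (hf : ContDiffOn ℝ ∞ f U) {u : E n}
    (hu : u ∈ U) : DifferentiableAt ℝ f u :=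
  (hf.contDiffAt (hU.mem_nhds hu)).differentiableAt (by simp)

theorem pd_flatForm {n : ℕ} (ε : ℝ) {V W : E n → E 3} {u : E n} (hV : DifferentiableAt ℝ V u)
    (hW : DifferentiableAt ℝ W u) (i : Fin n) :
    pd i (fun y => flatForm ε (V y) (W y)) u =
      flatForm ε (vd i V u) (W u) + flatForm ε (V u) (vd i W u) := by
  have dV := differentiableAt_apply hV
  have dW := differentiableAt_apply hW
  have d : ∀ k, DifferentiableAt ℝ (fun y => V y k * W y k) u := fun k => (dV k).mul (dW k)
  have c : ∀ f : E n → ℝ, DifferentiableAt ℝ f u → pd i (fun y => ε * f y) u = ε * pd i f u := by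
    intro f hf
    unfold pd
    rw [fderiv_const_mul hf]; rfl
  unfold flatForm
  rw [pd_add ((d 0).fun_add (d 1)) ((d 2).const_mul ε), pd_add (d 0) (d 1), c _ (d 2),
    pd_mul (dV 0) (dW 0), pd_mul (dV 1) (dW 1), pd_mul (dV 2) (dW 2)]
  simp only [pd_apply hV, pd_apply hW]
  ring

theorem vd_comm {n : ℕ} {V : E n → E 3} {U : Set (E n)} (hU : IsOpen U)
    (hV : ContDiffOn ℝ ∞ V U) {u : E n} (hu : u ∈ U) (i j : Fin n) :
    vd i (vd j V) u = vd j (vd i V) u := by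
  have hc : ContDiffAt ℝ ∞ V u := hV.contDiffAt (hU.mem_nhds hu)
  have hd : DifferentiableAt ℝ (fderiv ℝ V) u :=
    differentiableAt_of_contDiffOn hU (hV.fderiv_of_isOpen hU (m := ∞) (by simp)) hu
  have hs : IsSymmSndFDerivAt ℝ V u := hc.isSymmSndFDerivAt (by
    rw [minSmoothness_of_isRCLikeNormedField]; exact ENat.LEInfty.out)
  have e : ∀ k l : Fin n, vd k (vd l V) u =
      fderiv ℝ (fderiv ℝ V) u (EuclideanSpace.single k 1) (EuclideanSpace.single l 1) := by
    intro k l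
    unfold vd
    rw [fderiv_clm_apply hd (differentiableAt_const _)]
    simp
  rw [e, e, hs.eq]

/-! ### The Gauss equation in coordinates -/

/-- Christoffel symbols of the first kind. -/
def christoffelFirst {n : ℕ} (g : E n → Matrix (Fin n) (Fin n) ℝ) (k i j : Fin n) (u : E n) : ℝ :=
  (1 / 2 : ℝ) * (pd i (fun y => g y j k) u + pd j (fun y => g y i k) u - pd k (fun y => g y i j) u)

theorem christoffel_eq_sum {n : ℕ} (g : E n → Matrix (Fin n) (Fin n) ℝ) (k i j : Fin n)
    (u : E n) : christoffel g k i j u = ∑ l, (g u)⁻¹ k l * christoffelFirst g l i j u := by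
  unfold christoffel christoffelFirst
  rw [Finset.mul_sum]
  exact Finset.sum_congr rfl fun l _ => by ring

theorem contDiffOn_christoffelFirst {n : ℕ} {g : E n → Matrix (Fin n) (Fin n) ℝ} {U : Set (E n)}
    (hU : IsOpen U) (hg : ∀ i j, ContDiffOn ℝ ∞ (fun y => g y i j) U) (k i j : Fin n) :
    ContDiffOn ℝ ∞ (christoffelFirst g k i j) U :=
  contDiffOn_const.mul (((contDiffOn_pd hU (hg j k) i).add (contDiffOn_pd hU (hg i k) j)).sub
    (contDiffOn_pd hU (hg i j) k))

theorem contDiffOn_inv_fin_two {g : E 2 → Matrix (Fin 2) (Fin 2) ℝ} {U : Set (E 2)}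
    (hg : ∀ i j, ContDiffOn ℝ ∞ (fun y => g y i j) U) (hdet : ∀ y ∈ U, (g y).det ≠ 0)
    (i j : Fin 2) : ContDiffOn ℝ ∞ (fun y => (g y)⁻¹ i j) U := by
  have hd : ContDiffOn ℝ ∞ (fun y => (g y).det) U := by
    simp only [Matrix.det_fin_two]
    exact ((hg 0 0).mul (hg 1 1)).sub ((hg 0 1).mul (hg 1 0))
  have hi := hd.inv hdet
  simp only [Matrix.inv_def, Matrix.adjugate_fin_two, Ring.inverse_eq_inv', Matrix.smul_apply,
    smul_eq_mul]
  refine hi.mul ?_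
  fin_cases i <;> fin_cases j <;> simp
  · exact hg 1 1
  · exact (hg 0 1).neg
  · exact (hg 1 0).neg
  · exact hg 0 0

theorem sum_mul_christoffel {n : ℕ} {g : E n → Matrix (Fin n) (Fin n) ℝ} {u : E n}
    (hdet : (g u).det ≠ 0) (k i j : Fin n) :
    ∑ l, g u k l * christoffel g l i j u = christoffelFirst g k i j u := by
  simp only [christoffel_eq_sum, Finset.mul_sum, ← mul_assoc]
  rw [Finset.sum_comm]
  simp only [← Finset.sum_mul, ← Matrix.mul_apply]
  rw [Matrix.mul_nonsing_inv _ (isUnit_iff_ne_zero.mpr hdet)]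
  simp [Matrix.one_apply]

/-- Lowering the index of `R(∂₀, ∂₁)∂₁` moves `g` inside the derivatives of the Christoffel symbols.
The resulting `∂g` terms, split by metric compatibility (`hcompat`), partly cancel the quadratic
terms of the curvature. The surviving sum is a difference of inner products of tangential parts, the
shape needed for the Gauss equation. -/
theorem coordGaussCurvature_mul_det {g : E 2 → Matrix (Fin 2) (Fin 2) ℝ} {U : Set (E 2)}
    (hU : IsOpen U) (hg : ∀ i j, ContDiffOn ℝ ∞ (fun y => g y i j) U)
    (hsymm : ∀ y i j, g y i j = g y j i) (hdet : ∀ y ∈ U, (g y).det ≠ 0) {u : E 2} (hu : u ∈ U) :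
    coordGaussCurvature g u * (g u).det =
      pd 0 (christoffelFirst g 0 1 1) u - pd 1 (christoffelFirst g 0 0 1) u
        - ∑ l, (christoffelFirst g l 0 0 u * christoffel g l 1 1 u
          - christoffelFirst g l 0 1 u * christoffel g l 0 1 u) := by
  have hΓ : ∀ k i j, DifferentiableAt ℝ (christoffel g k i j) u := by
    intro k i j
    refine differentiableAt_of_contDiffOn hU ?_ hu
    simp only [funext (christoffel_eq_sum g k i j)]
    exact ContDiffOn.sum fun l _ => (contDiffOn_inv_fin_two hg hdet k l).mul
      (contDiffOn_christoffelFirst hU hg l i j)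
  have hgd : ∀ i j, DifferentiableAt ℝ (fun y => g y i j) u :=
    fun i j => differentiableAt_of_contDiffOn hU (hg i j) hu
  have hcompat : ∀ k i j, pd k (fun y => g y i j) u =
      christoffelFirst g i k j u + christoffelFirst g j k i u := by
    intro k i j
    unfold christoffelFirst
    simp only [hsymm _ j i]
    ring
  have hcs : ∀ k i j, christoffelFirst g k i j u = christoffelFirst g k j i u := by
    intro k i j
    unfold christoffelFirst
    simp only [hsymm _ i j]
    ring
  have hder : ∀ m k i j, pd m (christoffelFirst g k i j) u =
      (pd m (fun y => g y k 0) u * christoffel g 0 i j u + g u k 0 * pd m (christoffel g 0 i j) u)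
      + (pd m (fun y => g y k 1) u * christoffel g 1 i j u
        + g u k 1 * pd m (christoffel g 1 i j) u) := by
    intro m k i j
    rw [← pd_mul (hgd k 0) (hΓ 0 i j), ← pd_mul (hgd k 1) (hΓ 1 i j),
      ← pd_add ((hgd k 0).fun_mul (hΓ 0 i j)) ((hgd k 1).fun_mul (hΓ 1 i j))]
    refine pd_congr hU (fun y hy => ?_) hu m
    simp only [← sum_mul_christoffel (hdet y hy), Fin.sum_univ_two]
  have hs := fun k i j => sum_mul_christoffel (hdet u hu) k i j
  simp only [Fin.sum_univ_two] at hs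
  unfold coordGaussCurvature
  rw [div_mul_cancel₀ _ (hdet u hu), hder, hder]
  simp only [hcompat, riemann, Fin.sum_univ_two]
  rw [hcs 0 1 0, hcs 1 1 0]
  have a₁ := hs 0 0 0
  have a₂ := hs 0 0 1
  have a₃ := hs 0 1 0
  have a₄ := hs 0 1 1
  rw [hcs] at a₃
  linear_combination christoffel g 0 1 1 u * a₁ + christoffel g 1 1 1 u * a₂
    - christoffel g 0 0 1 u * a₃ - christoffel g 1 0 1 u * a₄

/-- Partial derivatives of a map into the upper half-space, left-translated to the identity. -/
def frame (X : E 2 → E 3) (i : Fin 2) (u : E 2) : E 3 := (X u 2)⁻¹ • vd i X u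

/-- The left-translated ambient covariant derivatives of the coordinate frame of a surface. -/
def frameDeriv (ε : ℝ) (X : E 2 → E 3) (i j : Fin 2) (u : E 2) : E 3 :=
  vd i (frame X j) u - frame X j u 2 • frame X i u
    + flatForm ε (frame X i u) (frame X j u) • (ε • EuclideanSpace.single 2 (1 : ℝ))

/-- The metric induced on a surface in the upper half-space. -/
def frameMetric (ε : ℝ) (X : E 2 → E 3) (u : E 2) : Matrix (Fin 2) (Fin 2) ℝ :=
  Matrix.of fun i j => flatForm ε (frame X i u) (frame X j u)

theorem det_frameMetric (ε : ℝ) (X : E 2 → E 3) (u : E 2) :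
    (frameMetric ε X u).det = flatForm ε (frame X 0 u) (frame X 0 u) *
      flatForm ε (frame X 1 u) (frame X 1 u) - flatForm ε (frame X 0 u) (frame X 1 u) ^ 2 := by
  simp only [Matrix.det_fin_two, frameMetric, Matrix.of_apply]
  rw [flatForm_comm ε (frame X 1 u) (frame X 0 u)]
  ring

/-! ### Structure equations of the translated frame and the Gauss equation -/

section Gauss

variable {ε : ℝ} {X : E 2 → E 3} {U : Set (E 2)}

theorem contDiffOn_frame (hU : IsOpen U) (hX : ContDiffOn ℝ ∞ X U) (hpos : ∀ u ∈ U, 0 < X u 2)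
    (i : Fin 2) : ContDiffOn ℝ ∞ (frame X i) U :=
  ((contDiffOn_apply hX 2).inv fun u hu => (hpos u hu).ne').smul (contDiffOn_vd hU hX i)

theorem contDiffOn_frameDeriv (hU : IsOpen U) (hX : ContDiffOn ℝ ∞ X U)
    (hpos : ∀ u ∈ U, 0 < X u 2) (i j : Fin 2) : ContDiffOn ℝ ∞ (frameDeriv ε X i j) U := by
  have h := contDiffOn_frame hU hX hpos
  exact ((contDiffOn_vd hU (h j) i).sub ((contDiffOn_apply (h j) 2).smul (h i))).add
    ((contDiffOn_flatForm ε (h i) (h j)).smul contDiffOn_const)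

/-- Maurer–Cartan equation: differentiating `∂ⱼX = X₃ tⱼ` shows that both sides equal `X₃⁻¹ ∂ᵢ∂ⱼX`.
-/
theorem frame_structure (hU : IsOpen U) (hX : ContDiffOn ℝ ∞ X U) (hpos : ∀ u ∈ U, 0 < X u 2)
    {u : E 2} (hu : u ∈ U) (i j : Fin 2) :
    vd i (frame X j) u + frame X i u 2 • frame X j u =
      vd j (frame X i) u + frame X j u 2 • frame X i u := by
  have hz := (hpos u hu).ne'
  have e : ∀ i j, vd i (frame X j) u + frame X i u 2 • frame X j u =
      (X u 2)⁻¹ • vd i (vd j X) u := by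
    intro i j
    have h1 : Set.EqOn (vd j X) (fun y => X y 2 • frame X j y) U := by
      intro y hy
      simp only [frame]
      rw [smul_inv_smul₀ (hpos y hy).ne']
    have dX := differentiableAt_of_contDiffOn hU hX hu
    rw [vd_congr hU h1 hu, vd_smul (differentiableAt_apply dX 2)
      (differentiableAt_of_contDiffOn hU (contDiffOn_frame hU hX hpos j) hu), pd_apply dX,
      smul_add, inv_smul_smul₀ hz, add_comm, smul_smul]
    rfl
  rw [e, e, vd_comm hU hX hu]

theorem frameDeriv_comm (hU : IsOpen U) (hX : ContDiffOn ℝ ∞ X U) (hpos : ∀ u ∈ U, 0 < X u 2)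
    {u : E 2} (hu : u ∈ U) (i j : Fin 2) : frameDeriv ε X i j u = frameDeriv ε X j i u := by
  have h := frame_structure hU hX hpos hu i j
  unfold frameDeriv
  rw [flatForm_comm ε (frame X i u), eq_sub_of_add_eq h]
  abel

theorem flatForm_single (hε : ε * ε = 1) (a : E 3) :
    flatForm ε (ε • EuclideanSpace.single 2 (1 : ℝ)) a = a 2 := by
  simp [flatForm, ← mul_assoc, hε]

/-- Metric compatibility: the correction terms in `frameDeriv` act skew-symmetrically on the frame,
hence cancel in the sum. -/
theorem pd_frameMetric (hε : ε * ε = 1) (hU : IsOpen U) (hX : ContDiffOn ℝ ∞ X U)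
    (hpos : ∀ u ∈ U, 0 < X u 2) {u : E 2} (hu : u ∈ U) (k i j : Fin 2) :
    pd k (fun y => frameMetric ε X y i j) u =
      flatForm ε (frameDeriv ε X k i u) (frame X j u)
        + flatForm ε (frameDeriv ε X k j u) (frame X i u) := by
  have d := fun i => differentiableAt_of_contDiffOn hU (contDiffOn_frame hU hX hpos i) hu
  simp only [frameMetric, Matrix.of_apply]
  rw [pd_flatForm ε (d i) (d j)]
  simp only [frameDeriv, flatForm_add_left, flatForm_sub_left, flatForm_smul_left _ _ _,
    flatForm_comm ε (vd k (frame X j) u)]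
  have s := fun a => flatForm_single hε a
  simp only [flatForm_smul_left] at s
  simp only [s]
  ring

/-- Koszul's argument: compatibility together with the symmetry of `frameDeriv` (absence of
torsion). -/
theorem christoffelFirst_frameMetric (hε : ε * ε = 1) (hU : IsOpen U) (hX : ContDiffOn ℝ ∞ X U)
    (hpos : ∀ u ∈ U, 0 < X u 2) {u : E 2} (hu : u ∈ U) (k i j : Fin 2) :
    christoffelFirst (frameMetric ε X) k i j u =
      flatForm ε (frameDeriv ε X i j u) (frame X k u) := by
  unfold christoffelFirst
  simp only [pd_frameMetric hε hU hX hpos hu]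
  rw [frameDeriv_comm hU hX hpos hu j i, frameDeriv_comm hU hX hpos hu k i,
    frameDeriv_comm hU hX hpos hu k j]
  ring

theorem vd_frameDeriv (hU : IsOpen U) (hX : ContDiffOn ℝ ∞ X U)
    (hpos : ∀ u ∈ U, 0 < X u 2) {u : E 2} (hu : u ∈ U) (k i j : Fin 2) :
    vd k (frameDeriv ε X i j) u = vd k (vd i (frame X j)) u
      - (vd k (frame X j) u 2 • frame X i u + frame X j u 2 • vd k (frame X i) u)
      + (flatForm ε (vd k (frame X i) u) (frame X j u)
        + flatForm ε (frame X i u) (vd k (frame X j) u)) •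
          (ε • EuclideanSpace.single 2 (1 : ℝ)) := by
  have h := contDiffOn_frame hU hX hpos
  have d := fun i => differentiableAt_of_contDiffOn hU (h i) hu
  have d₁ := differentiableAt_of_contDiffOn hU (contDiffOn_vd hU (h j) i) hu
  have d₂ := (differentiableAt_apply (d j) 2).fun_smul (d i)
  have d₃ := differentiableAt_of_contDiffOn hU (contDiffOn_flatForm ε (h i) (h j)) hu
  have d₄ : DifferentiableAt ℝ
    (fun _ : E 2 => (ε • EuclideanSpace.single 2 (1 : ℝ) : E 3)) u := differentiableAt_const _
  unfold frameDeriv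
  rw [vd_add (d₁.fun_sub d₂) (d₃.fun_smul d₄), vd_sub d₁ d₂,
    vd_smul (differentiableAt_apply (d j) 2) (d i), vd_smul d₃ d₄, pd_apply (d j),
    pd_flatForm ε (d i) (d j)]
  simp [vd]

/-- The term `-ε det` is the constant ambient curvature. Second derivatives of the frame cancel by
symmetry. -/
theorem frame_curvature (hε : ε * ε = 1) (hU : IsOpen U) (hX : ContDiffOn ℝ ∞ X U)
    (hpos : ∀ u ∈ U, 0 < X u 2) {u : E 2} (hu : u ∈ U) :
    pd 0 (christoffelFirst (frameMetric ε X) 0 1 1) u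
        - pd 1 (christoffelFirst (frameMetric ε X) 0 0 1) u =
      -ε * (frameMetric ε X u).det
        + flatForm ε (frameDeriv ε X 0 0 u) (frameDeriv ε X 1 1 u)
        - flatForm ε (frameDeriv ε X 0 1 u) (frameDeriv ε X 0 1 u) := by
  have h := contDiffOn_frame hU hX hpos
  have d := fun i => differentiableAt_of_contDiffOn hU (h i) hu
  have dT := fun i j => differentiableAt_of_contDiffOn hU
    (contDiffOn_frameDeriv (ε := ε) hU hX hpos i j) hu
  rw [pd_congr hU (fun y hy => christoffelFirst_frameMetric hε hU hX hpos hy 0 1 1) hu,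
    pd_congr hU (fun y hy => christoffelFirst_frameMetric hε hU hX hpos hy 0 0 1) hu,
    pd_flatForm ε (dT 1 1) (d 0), pd_flatForm ε (dT 0 1) (d 0), vd_frameDeriv hU hX hpos hu,
    vd_frameDeriv hU hX hpos hu, vd_comm hU (h 1) hu 0 1, det_frameMetric]
  -- Eliminating `∂₀t₁` in favour of `∂₁t₀` leaves a polynomial identity in independent quantities.
  have hs := eq_sub_of_add_eq (frame_structure hU hX hpos hu 0 1)
  unfold frameDeriv
  simp only [hs]
  have : ε = 1 ∨ ε = -1 := mul_self_eq_one_iff.mp hε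
  rcases this with rfl | rfl <;>
  · simp [flatForm]
    ring

/-- The Gauss equation. -/
theorem gauss_equation (hε : ε * ε = 1) (hU : IsOpen U) (hX : ContDiffOn ℝ ∞ X U)
    (hpos : ∀ u ∈ U, 0 < X u 2) (hdet : ∀ u ∈ U, (frameMetric ε X u).det ≠ 0) {u : E 2}
    (hu : u ∈ U) {m : E 3} (hm : flatForm ε m m = ε) (hmt : ∀ i, flatForm ε m (frame X i u) = 0) :
    coordGaussCurvature (frameMetric ε X) u = -ε + ε *
      ((flatForm ε (frameDeriv ε X 0 0 u) m * flatForm ε (frameDeriv ε X 1 1 u) m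
        - flatForm ε (frameDeriv ε X 0 1 u) m ^ 2) / (frameMetric ε X u).det) := by
  have h := contDiffOn_frame hU hX hpos
  have hD := hdet u hu
  have hg : ∀ i j, ContDiffOn ℝ ∞ (fun y => frameMetric ε X y i j) U :=
    fun i j => contDiffOn_flatForm ε (h i) (h j)
  have key := coordGaussCurvature_mul_det hU hg (fun y i j => flatForm_comm _ _ _) hdet hu
  rw [frame_curvature hε hU hX hpos hu] at key
  simp only [Fin.sum_univ_two, christoffel_eq_sum,
    christoffelFirst_frameMetric hε hU hX hpos hu, Matrix.inv_def, Matrix.adjugate_fin_two,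
    Ring.inverse_eq_inv', Matrix.smul_apply, smul_eq_mul] at key
  have hD' := hD
  rw [det_frameMetric] at hD'
  -- Split the products of ambient derivatives into tangential and normal parts; the tangential ones
  -- cancel against the Christoffel sum in `key`.
  have k₁ := flatForm_expand hε hm (hmt 0) (hmt 1) hD' (frameDeriv ε X 0 0 u) (frameDeriv ε X 1 1 u)
  have k₂ := flatForm_expand hε hm (hmt 0) (hmt 1) hD' (frameDeriv ε X 0 1 u) (frameDeriv ε X 0 1 u)
  rw [← det_frameMetric] at k₁ k₂
  have e : ∀ i j, frameMetric ε X u i j = flatForm ε (frame X i u) (frame X j u) := fun _ _ => rfl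
  simp only [Matrix.of_apply, Matrix.cons_val', Matrix.cons_val_zero, Matrix.cons_val_one,
    Matrix.cons_val_fin_one, e, flatForm_comm ε (frame X 1 u) (frame X 0 u)] at key
  have hI := inv_mul_cancel₀ hD
  rw [div_eq_inv_mul]
  generalize (frameMetric ε X u).det⁻¹ = I at *
  generalize (frameMetric ε X u).det = D at *
  apply mul_right_cancel₀ hD
  linear_combination key + I * k₁ - I * k₂ -
    (flatForm ε (frameDeriv ε X 0 0 u) (frameDeriv ε X 1 1 u)
      - flatForm ε (frameDeriv ε X 0 1 u) (frameDeriv ε X 0 1 u)) * hI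

end Gauss

/-! ### The ambient connection -/

theorem inv_ambientMatrix {ε : ℝ} (hε : ε * ε = 1) {y : E 3} (hy : y 2 ≠ 0) :
    (ambientMatrix ε y)⁻¹ = !![y 2 ^ 2, 0, 0; 0, y 2 ^ 2, 0; 0, 0, ε * y 2 ^ 2] := by
  apply Matrix.inv_eq_right_inv
  ext i j
  fin_cases i <;> fin_cases j <;>
    simp [ambientMatrix, ambientForm, flatForm, Matrix.mul_apply, Fin.sum_univ_three, hy]
  field_simp
  linear_combination hε

theorem pd_ambientMatrix (ε : ℝ) {y : E 3} (hy : y 2 ≠ 0) (l i j : Fin 3) :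
    pd l (fun y => ambientMatrix ε y i j) y =
      flatForm ε (EuclideanSpace.single i 1) (EuclideanSpace.single j 1) *
        (-2 / y 2 ^ 3 * (EuclideanSpace.single l (1 : ℝ) : E 3) 2) := by
  have h : HasFDerivAt (fun y : E 3 => y 2) (EuclideanSpace.proj (𝕜 := ℝ) 2 : E 3 →L[ℝ] ℝ) y :=
    (EuclideanSpace.proj (𝕜 := ℝ) 2 : E 3 →L[ℝ] ℝ).hasFDerivAt
  have h₁ := (((hasDerivAt_pow 2 (y 2)).fun_inv (pow_ne_zero 2 hy)).comp_hasFDerivAt y h).const_mul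
    (flatForm ε (EuclideanSpace.single i 1) (EuclideanSpace.single j 1))
  unfold pd
  simp only [ambientMatrix, ambientForm, Matrix.of_apply, div_eq_mul_inv]
  erw [h₁.fderiv]
  simp
  field_simp

/-- The conformal change formula for the flat form scaled by `e^{2φ}` with `φ = -log y₃`, whose flat
gradient is `-(ε / y₃) e₃`. -/
theorem sum_christoffel_ambientMatrix {ε : ℝ} (hε : ε * ε = 1) {y : E 3} (hy : y 2 ≠ 0)
    (a b : E 3) (k : Fin 3) :
    ∑ i, ∑ j, christoffel (ambientMatrix ε) k i j y * a i * b j =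
      -(a 2 / y 2) * b k - b 2 / y 2 * a k
        + flatForm ε a b / y 2 * (ε • EuclideanSpace.single 2 (1 : ℝ) : E 3) k := by
  simp only [christoffel, pd_ambientMatrix ε hy, inv_ambientMatrix hε hy, Fin.sum_univ_three]
  have : ε = 1 ∨ ε = -1 := mul_self_eq_one_iff.mp hε
  rcases this with rfl | rfl <;> fin_cases k <;> simp [flatForm] <;> field_simp <;> ring

/-! ### Surfaces in a chart -/

section Surface

variable {M : Type*} [TopologicalSpace M] [ChartedSpace (E 2) M]

/-- The expression of a map in the chart at `p`. -/
def inChart {F : Type*} (p : M) (f : M → F) : E 2 → F := f ∘ (extChartAt (𝓡 2) p).symm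

theorem inChart_self {F : Type*} (p : M) (f : M → F) :
    inChart p f (extChartAt (𝓡 2) p p) = f p := by
  simp [inChart]

theorem diff_eq_fderiv {f : M → E 3} {p : M} (hf : MDifferentiableAt (𝓡 2) 𝓘(ℝ, E 3) f p) :
    diff f p = fderiv ℝ (inChart p f) (extChartAt (𝓡 2) p p) := by
  unfold diff
  simp only [mfderiv, hf]
  rw [ModelWithCorners.range_eq_univ, fderivWithin_univ]
  rfl

theorem diff_apply {f : M → E 3} {p : M} (hf : MDifferentiableAt (𝓡 2) 𝓘(ℝ, E 3) f p) (v : E 2) :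
    diff f p v = v 0 • vd 0 (inChart p f) (extChartAt (𝓡 2) p p)
      + v 1 • vd 1 (inChart p f) (extChartAt (𝓡 2) p p) := by
  have hv : v = v 0 • EuclideanSpace.single 0 1 + v 1 • EuclideanSpace.single 1 1 := by
    ext i
    fin_cases i <;> simp
  have h := congrArg (fderiv ℝ (inChart p f) (extChartAt (𝓡 2) p p)) hv
  rw [map_add, map_smul, map_smul] at h
  rw [diff_eq_fderiv hf]
  exact h

/-- Left translation by the inverse is affine, with linear part division by `x₃`. -/
theorem normalGaussMap_eq {P : Type*} (x N : P → E 3) (q : P) :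
    normalGaussMap x N q = (x q 2)⁻¹ • N q := by
  unfold normalGaussMap
  have h : groupMul (groupInv (x q)) =
      fun b => (x q 2)⁻¹ • b + !₂[-(x q 0 / x q 2), -(x q 1 / x q 2), 0] := by
    funext b
    ext i
    fin_cases i <;> simp [groupMul, groupInv]
  rw [h, fderiv_add_const, fderiv_fun_const_smul differentiableAt_fun_id]
  simp

variable {ε : ℝ} {x N : M → E 3}

theorem IsSurface.contMDiff_normalGaussMap (hS : IsSurface ε x N) :
    ContMDiff (𝓡 2) 𝓘(ℝ, E 3) ∞ (normalGaussMap x N) := by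
  rw [funext (normalGaussMap_eq x N)]
  have h2 : ContMDiff (𝓡 2) 𝓘(ℝ, ℝ) ∞ (fun q => x q 2) :=
    (EuclideanSpace.proj (𝕜 := ℝ) 2 : E 3 →L[ℝ] ℝ).contDiff.contMDiff.comp hS.smooth
  exact (h2.inv₀ fun q => (hS.pos q).ne').smul hS.normal_smooth

theorem IsSurface.flatForm_normalGaussMap (hS : IsSurface ε x N) (q : M) :
    flatForm ε (normalGaussMap x N q) (normalGaussMap x N q) = ε := by
  rw [normalGaussMap_eq, flatForm_smul_left, flatForm_smul_right]
  have h := hS.normal_unit q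
  rw [ambientForm] at h
  rw [div_eq_mul_inv] at h
  linear_combination h

theorem IsSurface.flatForm_normalGaussMap_diff (hS : IsSurface ε x N) (q : M)
    (v : TangentSpace (𝓡 2) q) : flatForm ε (normalGaussMap x N q) (diff x q v) = 0 := by
  have h := hS.normal_orthogonal q v
  have hz := (hS.pos q).ne'
  rw [ambientForm, div_eq_zero_iff] at h
  rw [normalGaussMap_eq, flatForm_smul_left, h.resolve_right (pow_ne_zero 2 hz), mul_zero]

theorem ambientForm_eq_flatForm (ε : ℝ) (y a b : E 3) :
    ambientForm ε y a b = flatForm ε ((y 2)⁻¹ • a) ((y 2)⁻¹ • b) := by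
  rw [ambientForm, flatForm_smul_left, flatForm_smul_right]
  ring

theorem chartMetric_eq_frameMetric (ε : ℝ) (x : M → E 3) (p : M) :
    chartMetric ε x p = frameMetric ε (inChart p x) := by
  funext u
  ext i j
  simp only [chartMetric, frameMetric, Matrix.of_apply, ambientForm_eq_flatForm]
  rfl

theorem det_frameMetric_pos (hS : IsSurface ε x N) (p : M) :
    0 < (frameMetric ε (inChart p x) (extChartAt (𝓡 2) p p)).det := by
  set u := extChartAt (𝓡 2) p p
  have hq : ∀ a b : ℝ, a ≠ 0 ∨ b ≠ 0 →
      0 < flatForm ε (a • frame (inChart p x) 0 u + b • frame (inChart p x) 1 u)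
        (a • frame (inChart p x) 0 u + b • frame (inChart p x) 1 u) := by
    intro a b hab
    have hv : (!₂[a, b] : E 2) ≠ 0 := by
      intro h
      have h0 := congrArg (fun v : E 2 => v 0) h
      have h1 := congrArg (fun v : E 2 => v 1) h
      simp at h0 h1
      tauto
    have h := hS.spacelike p _ hv
    rw [ambientForm_eq_flatForm, diff_apply ((hS.smooth p).mdifferentiableAt (by simp)),
      smul_add, smul_comm _ (_ : ℝ), smul_comm _ (_ : ℝ) (vd 1 _ _)] at h
    unfold frame
    rw [inChart_self]
    exact h
  have h0 := hq 1 0 (by simp)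
  rw [one_smul, zero_smul, add_zero] at h0
  -- At `(-g₀₁, g₀₀)` the quadratic form takes the value `g₀₀ · det g`.
  have h1 := hq (-flatForm ε (frame (inChart p x) 0 u) (frame (inChart p x) 1 u))
    (flatForm ε (frame (inChart p x) 0 u) (frame (inChart p x) 0 u)) (Or.inr h0.ne')
  simp only [flatForm_add_left, flatForm_add_right, flatForm_smul_left, flatForm_smul_right] at h1
  rw [flatForm_comm ε (frame (inChart p x) 1 u) (frame (inChart p x) 0 u)] at h1
  rw [det_frameMetric]
  refine pos_of_mul_pos_right (a := flatForm ε (frame (inChart p x) 0 u) (frame (inChart p x) 0 u))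
    ?_ h0.le
  linarith

variable [IsManifold (𝓡 2) ∞ M]

theorem contDiffOn_inChart {f : M → E 3} (hf : ContMDiff (𝓡 2) 𝓘(ℝ, E 3) ∞ f) (p : M) :
    ContDiffOn ℝ ∞ (inChart p f) (extChartAt (𝓡 2) p).target :=
  (hf.comp_contMDiffOn (contMDiffOn_extChartAt_symm p)).contDiffOn

theorem fderiv_inChart {f : M → E 3} (hf : ContMDiff (𝓡 2) 𝓘(ℝ, E 3) ∞ f) (p : M) {u : E 2}
    (hu : u ∈ (extChartAt (𝓡 2) p).target) (v : E 2) :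
    fderiv ℝ (inChart p f) u v = diff f ((extChartAt (𝓡 2) p).symm u)
      (mfderiv 𝓘(ℝ, E 2) (𝓡 2) (extChartAt (𝓡 2) p).symm u v) := by
  have hs : MDifferentiableAt 𝓘(ℝ, E 2) (𝓡 2) (extChartAt (𝓡 2) p).symm u :=
    ((contMDiffOn_extChartAt_symm (n := ∞) p).contMDiffAt
      ((isOpen_extChartAt_target p).mem_nhds hu)).mdifferentiableAt (by simp)
  have hfd := (hf ((extChartAt (𝓡 2) p).symm u)).mdifferentiableAt (by simp)
  rw [← mfderiv_eq_fderiv]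
  unfold inChart diff
  rw [mfderiv_comp u hfd hs]
  rfl

theorem IsSurface.diff_normal (hS : IsSurface ε x N) (p : M) (v : TangentSpace (𝓡 2) p) :
    diff N p v = diff x p v 2 • normalGaussMap x N p + x p 2 • diff (normalGaussMap x N) p v := by
  have hη := hS.contMDiff_normalGaussMap
  have e : inChart p N = fun u => inChart p x u 2 • inChart p (normalGaussMap x N) u := by
    funext u
    simp only [inChart, Function.comp_apply, normalGaussMap_eq]
    rw [smul_inv_smul₀ (hS.pos _).ne']
  have hu := mem_extChartAt_target (I := 𝓡 2) p
  have hU := isOpen_extChartAt_target (I := 𝓡 2) p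
  have dX := differentiableAt_of_contDiffOn hU (contDiffOn_inChart hS.smooth p) hu
  have dH := differentiableAt_of_contDiffOn hU (contDiffOn_inChart hη p) hu
  have h2 := ((EuclideanSpace.proj (𝕜 := ℝ) 2 : E 3 →L[ℝ] ℝ).hasFDerivAt.comp _
    dX.hasFDerivAt)
  have key := (h2.fun_smul dH.hasFDerivAt).fderiv
  rw [diff_eq_fderiv ((hS.smooth p).mdifferentiableAt (by simp)),
    diff_eq_fderiv ((hη p).mdifferentiableAt (by simp)),
    diff_eq_fderiv ((hS.normal_smooth p).mdifferentiableAt (by simp)), e]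
  erw [key]
  rw [← inChart_self p x, ← inChart_self p (normalGaussMap x N), add_comm]
  rfl

/-- In `N = x₃ η` the derivative of the factor `x₃` cancels one Christoffel term, and another
contains `⟨dx(v), N⟩ = 0`. -/
theorem IsSurface.covDeriv_eq (hε : ε * ε = 1) (hS : IsSurface ε x N) (p : M)
    (v : TangentSpace (𝓡 2) p) :
    covDeriv ε x N p v =
      x p 2 • diff (normalGaussMap x N) p v - normalGaussMap x N p 2 • diff x p v := by
  have hz := (hS.pos p).ne'
  have h := hS.normal_orthogonal p v
  rw [ambientForm, div_eq_zero_iff] at h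
  replace h := h.resolve_right (pow_ne_zero 2 hz)
  rw [flatForm_comm] at h
  ext k
  simp only [covDeriv, sum_christoffel_ambientMatrix hε hz, hS.diff_normal, h]
  simp only [normalGaussMap_eq, PiLp.add_apply, PiLp.sub_apply, PiLp.smul_apply, smul_eq_mul]
  field_simp
  ring

theorem IsSurface.secondForm_eq (hε : ε * ε = 1) (hS : IsSurface ε x N) (p : M)
    (v w : TangentSpace (𝓡 2) p) :
    secondForm ε x N p v w =
      -ε * (flatForm ε (diff (normalGaussMap x N) p v) ((x p 2)⁻¹ • diff x p w)
        - normalGaussMap x N p 2 *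
          flatForm ε ((x p 2)⁻¹ • diff x p v) ((x p 2)⁻¹ • diff x p w)) := by
  have hz := (hS.pos p).ne'
  rw [secondForm, hS.covDeriv_eq hε, ambientForm, flatForm_sub_left]
  simp only [flatForm_smul_left, flatForm_smul_right]
  field_simp

end Surface

/-! ### The fourth fundamental form and conformality -/

section Surface

variable {M : Type*} [TopologicalSpace M] [ChartedSpace (E 2) M] [IsManifold (𝓡 2) ∞ M]
  {ε : ℝ} {x N : M → E 3}

theorem IsSurface.flatForm_inChart_frame (hS : IsSurface ε x N) (p : M) {u : E 2}
    (hu : u ∈ (extChartAt (𝓡 2) p).target) (i : Fin 2) :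
    flatForm ε (inChart p (normalGaussMap x N) u) (frame (inChart p x) i u) = 0 := by
  unfold frame vd
  rw [flatForm_smul_right, fderiv_inChart hS.smooth p hu]
  erw [hS.flatForm_normalGaussMap_diff]
  rw [mul_zero]

/-- The normal part of the derivative of the frame in terms of the derivative of the normal. -/
theorem IsSurface.flatForm_frameDeriv (hε : ε * ε = 1) (hS : IsSurface ε x N) (p : M) {u : E 2}
    (hu : u ∈ (extChartAt (𝓡 2) p).target) (i j : Fin 2) :
    flatForm ε (frameDeriv ε (inChart p x) i j u) (inChart p (normalGaussMap x N) u) =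
      -(flatForm ε (vd i (inChart p (normalGaussMap x N)) u) (frame (inChart p x) j u)
        - inChart p (normalGaussMap x N) u 2 *
          flatForm ε (frame (inChart p x) i u) (frame (inChart p x) j u)) := by
  have hU := isOpen_extChartAt_target (I := 𝓡 2) p
  have hX := contDiffOn_inChart hS.smooth p
  have hpos : ∀ u ∈ (extChartAt (𝓡 2) p).target, 0 < inChart p x u 2 := fun u _ => hS.pos _
  have dH := differentiableAt_of_contDiffOn hU
    (contDiffOn_inChart hS.contMDiff_normalGaussMap p) hu
  have dF := differentiableAt_of_contDiffOn hU (contDiffOn_frame hU hX hpos j) hu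
  -- Differentiate the identity `⟨η, tⱼ⟩ = 0`.
  have h := pd_congr hU (fun y hy => hS.flatForm_inChart_frame p hy j) hu i
  rw [pd_flatForm ε dH dF] at h
  have h0 : pd i (fun _ : E 2 => (0 : ℝ)) u = 0 := by simp [pd]
  rw [h0] at h
  have hi := hS.flatForm_inChart_frame p hu i
  rw [flatForm_comm] at hi
  unfold frameDeriv
  simp only [flatForm_add_left, flatForm_sub_left]
  have s := flatForm_single hε (inChart p (normalGaussMap x N) u)
  simp only [flatForm_smul_left] at s ⊢
  rw [s, hi, flatForm_comm ε (vd i (frame (inChart p x) j) u)]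
  linear_combination h

theorem IsSurface.flatForm_vd_normal (hS : IsSurface ε x N) (p : M) {u : E 2}
    (hu : u ∈ (extChartAt (𝓡 2) p).target) (i : Fin 2) :
    flatForm ε (vd i (inChart p (normalGaussMap x N)) u) (inChart p (normalGaussMap x N) u) = 0 := by
  have hU := isOpen_extChartAt_target (I := 𝓡 2) p
  have dH := differentiableAt_of_contDiffOn hU
    (contDiffOn_inChart hS.contMDiff_normalGaussMap p) hu
  have h := pd_congr (g := fun _ => ε) hU
    (fun y _ => hS.flatForm_normalGaussMap ((extChartAt (𝓡 2) p).symm y)) hu i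
  change pd i (fun y => flatForm ε (inChart p (normalGaussMap x N) y)
    (inChart p (normalGaussMap x N) y)) u = _ at h
  rw [pd_flatForm ε dH dH, flatForm_comm ε (inChart p (normalGaussMap x N) u)] at h
  have h0 : pd i (fun _ : E 2 => ε) u = 0 := by simp [pd]
  linarith

/-- The fourth fundamental form is a combination of the first and the second one, the
coefficient of the first being determined by the Gauss curvature and the normal Gauss map. -/
theorem IsSurface.fourthForm_eq (hε : ε * ε = 1) (hS : IsSurface ε x N) (p : M) :
    ∃ τ : ℝ, ∀ v w : TangentSpace (𝓡 2) p, fourthForm ε x N p v w =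
      (normalGaussMap x N p 2 ^ 2 - (1 + ε * gaussCurvature ε x p)) * firstForm ε x p v w
        + τ * secondForm ε x N p v w := by
  set η := normalGaussMap x N with hη_def
  set X := inChart p x with hX_def
  set H := inChart p η with hH_def
  set u := extChartAt (𝓡 2) p p with hu_def
  have hu : u ∈ (extChartAt (𝓡 2) p).target := mem_extChartAt_target (I := 𝓡 2) p
  have hO := isOpen_extChartAt_target (I := 𝓡 2) p
  have hX := contDiffOn_inChart hS.smooth p
  have hpos : ∀ u ∈ (extChartAt (𝓡 2) p).target, 0 < X u 2 := fun u _ => hS.pos _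
  have hm : flatForm ε (H u) (H u) = ε := hS.flatForm_normalGaussMap _
  have hmt : ∀ i, flatForm ε (H u) (frame X i u) = 0 := hS.flatForm_inChart_frame p hu
  have hD := (det_frameMetric_pos hS p).ne'
  have hD' := hD
  rw [det_frameMetric] at hD'
  have hh := hS.flatForm_frameDeriv hε p hu
  -- Symmetry of the second form, inherited from that of `frameDeriv`.
  have hsymm : flatForm ε (vd 0 H u) (frame X 1 u) = flatForm ε (vd 1 H u) (frame X 0 u) := by
    have h₁ := hh 0 1
    have h₂ := hh 1 0
    rw [frameDeriv_comm hO hX hpos hu 1 0, h₁, flatForm_comm ε (frame (inChart p x) 1 u)] at h₂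
    linarith
  -- The determinant is known to be nonzero only at the centre of the chart, while the Gauss
  -- equation needs it on an open set.
  let V := (extChartAt (𝓡 2) p).target ∩ (fun y => (frameMetric ε X y).det) ⁻¹' {0}ᶜ
  have hF := contDiffOn_frame hO hX hpos
  have hV : IsOpen V := by
    refine ContinuousOn.isOpen_inter_preimage ?_ hO isOpen_compl_singleton
    simp only [det_frameMetric]
    have hg := fun i j => (contDiffOn_flatForm ε (hF i) (hF j)).continuousOn
    exact ((hg 0 0).mul (hg 1 1)).sub ((hg 0 1).pow 2)
  have hK := gauss_equation hε hV (hX.mono Set.inter_subset_left) (fun y hy => hpos y hy.1)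
    (fun y hy => hy.2) (⟨hu, hD⟩ : u ∈ V) hm hmt
  have hK' : gaussCurvature ε x p = coordGaussCurvature (frameMetric ε X) u := by
    rw [gaussCurvature, chartMetric_eq_frameMetric]
  obtain ⟨τ, key⟩ := fourth_eq_algebra hε hm (hmt 0) (hmt 1) (hS.flatForm_vd_normal p hu 0)
    (hS.flatForm_vd_normal p hu 1) hsymm hD' (H u 2)
  -- The Gauss equation solved for `det B`; the sign in `flatForm_frameDeriv` disappears in the
  -- quadratic expression.
  have hcoef : ((flatForm ε (vd 0 H u) (frame X 0 u) - H u 2 *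
        flatForm ε (frame X 0 u) (frame X 0 u)) * (flatForm ε (vd 1 H u) (frame X 1 u) - H u 2 *
        flatForm ε (frame X 1 u) (frame X 1 u)) - (flatForm ε (vd 0 H u) (frame X 1 u) - H u 2 *
        flatForm ε (frame X 0 u) (frame X 1 u)) ^ 2) /
      (flatForm ε (frame X 0 u) (frame X 0 u) * flatForm ε (frame X 1 u) (frame X 1 u) -
        flatForm ε (frame X 0 u) (frame X 1 u) ^ 2) = 1 + ε * gaussCurvature ε x p := by
    rw [hK', hK, ← det_frameMetric, hh, hh, hh, neg_mul_neg, neg_sq]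
    generalize (_ - _ ^ 2) / (frameMetric ε (inChart p x) u).det = B
    linear_combination (1 - B) * hε
  rw [hcoef] at key
  have hHu : H u = η p := inChart_self p η
  have hXu : X u = x p := inChart_self p x
  have hdx := fun v : E 2 => diff_apply ((hS.smooth p).mdifferentiableAt (by simp)) v
  have hdη := fun v : E 2 => diff_apply ((hS.contMDiff_normalGaussMap p).mdifferentiableAt
    (by simp)) v
  have hframe : ∀ v : E 2, (x p 2)⁻¹ • diff x p v = v 0 • frame X 0 u + v 1 • frame X 1 u := by
    intro v
    rw [hdx, smul_add, smul_comm _ (v 0), smul_comm _ (v 1), ← hXu]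
    rfl
  have main : ∀ v w : E 2, fourthForm ε x N p v w =
      (η p 2 ^ 2 - (1 + ε * gaussCurvature ε x p)) * firstForm ε x p v w
        + τ * secondForm ε x N p v w := by
    intro v w
    have k := key (v 0) (v 1) (w 0) (w 1)
    rw [← hframe, ← hframe, ← hdη, ← hdη, hHu] at k
    have h₁ : firstForm ε x p v w = _ := ambientForm_eq_flatForm ε (x p) _ _
    have h₂ : secondForm ε x N p v w = _ := hS.secondForm_eq hε p v w
    exact k.trans (congrArg₂ (fun a b => _ * a + τ * b) h₁ h₂).symm
  exact ⟨τ, main⟩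

/-- Near `p`, `ρ` is the quotient of `IV(v, w)` by `II(v, w)` for `v, w` extended with constant
chart coordinates and chosen so that the denominator is nonzero at `p`. -/
theorem contMDiff_of_fourthForm_eq (hε : ε * ε = 1) (hS : IsSurface ε x N) {ρ : M → ℝ}
    (hne : ∀ p, ∃ v w : E 2, secondForm ε x N p v w ≠ 0)
    (hρ : ∀ (p : M) (v w : TangentSpace (𝓡 2) p),
      fourthForm ε x N p v w = ρ p * secondForm ε x N p v w) :
    ContMDiff (𝓡 2) 𝓘(ℝ, ℝ) ∞ ρ := by
  intro p
  obtain ⟨v, w, hvw⟩ := hne p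
  have hη := hS.contMDiff_normalGaussMap
  set X := inChart p x with hX_def
  set H := inChart p (normalGaussMap x N) with hH_def
  set U := (extChartAt (𝓡 2) p).target
  have hU : IsOpen U := isOpen_extChartAt_target (I := 𝓡 2) p
  have hu : extChartAt (𝓡 2) p p ∈ U := mem_extChartAt_target (I := 𝓡 2) p
  have hX : ContDiffOn ℝ ∞ X U := contDiffOn_inChart hS.smooth p
  have hH : ContDiffOn ℝ ∞ H U := contDiffOn_inChart hη p
  let F : E 2 → ℝ := fun u => flatForm ε (fderiv ℝ H u v) (fderiv ℝ H u w)
  let S : E 2 → ℝ := fun u => -ε * (flatForm ε (fderiv ℝ H u v) ((X u 2)⁻¹ • fderiv ℝ X u w)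
    - H u 2 * flatForm ε ((X u 2)⁻¹ • fderiv ℝ X u v) ((X u 2)⁻¹ • fderiv ℝ X u w))
  have hz : ContDiffOn ℝ ∞ (fun u => (X u 2)⁻¹) U :=
    (contDiffOn_apply hX 2).inv fun u _ => (hS.pos _).ne'
  have hF : ContDiffOn ℝ ∞ F U :=
    contDiffOn_flatForm ε (contDiffOn_fderiv_apply hU hH v) (contDiffOn_fderiv_apply hU hH w)
  have dX := fun a => hz.smul (contDiffOn_fderiv_apply hU hX a)
  have hSm : ContDiffOn ℝ ∞ S U := contDiffOn_const.mul
    ((contDiffOn_flatForm ε (contDiffOn_fderiv_apply hU hH v) (dX w)).sub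
      ((contDiffOn_apply hH 2).mul (contDiffOn_flatForm ε (dX v) (dX w))))
  have hFS : ∀ u ∈ U, F u = ρ ((extChartAt (𝓡 2) p).symm u) * S u := by
    intro u hu
    have h := hρ ((extChartAt (𝓡 2) p).symm u)
      (mfderiv 𝓘(ℝ, E 2) (𝓡 2) (extChartAt (𝓡 2) p).symm u v)
      (mfderiv 𝓘(ℝ, E 2) (𝓡 2) (extChartAt (𝓡 2) p).symm u w)
    rw [hS.secondForm_eq hε, fourthForm] at h
    simp only [F, S]
    simp only [hH_def, hX_def, fderiv_inChart hS.smooth p hu, fderiv_inChart hη p hu]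
    exact h
  have hS0 : S (extChartAt (𝓡 2) p p) ≠ 0 := by
    replace hvw := fun h => hvw ((hS.secondForm_eq hε p v w).trans h)
    rw [diff_eq_fderiv ((hS.smooth p).mdifferentiableAt (by simp)),
      diff_eq_fderiv ((hη p).mdifferentiableAt (by simp))] at hvw
    simp only [S]
    rw [hX_def, inChart_self, hH_def, inChart_self]
    exact hvw
  have hq : ContDiffAt ℝ ∞ (fun u => F u / S u) (extChartAt (𝓡 2) p p) :=
    (hF.contDiffAt (hU.mem_nhds hu)).div (hSm.contDiffAt (hU.mem_nhds hu)) hS0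
  have hcomp : ContMDiffAt (𝓡 2) 𝓘(ℝ, ℝ) ∞
      ((fun u => F u / S u) ∘ extChartAt (𝓡 2) p) p :=
    hq.contMDiffAt.comp p (contMDiffAt_extChartAt (n := ∞))
  refine hcomp.congr_of_eventuallyEq ?_
  have hSe : ∀ᶠ u in nhds (extChartAt (𝓡 2) p p), S u ≠ 0 :=
    (hSm.continuousOn.continuousAt (hU.mem_nhds hu)).eventually_ne hS0
  filter_upwards [(continuousAt_extChartAt (I := 𝓡 2) p).eventually hSe,
    extChartAt_source_mem_nhds (I := 𝓡 2) p] with q hq hqs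
  have h := hFS _ ((extChartAt (𝓡 2) p).map_source hqs)
  rw [(extChartAt (𝓡 2) p).left_inv hqs] at h
  simp only [Function.comp_apply]
  rw [h, mul_div_cancel_right₀ _ hq]

theorem isConformalNormalGauss_iff (hε : ε * ε = 1) (hS : IsSurface ε x N)
    (hu : ∀ p, ¬ IsUmbilic ε x N p) :
    IsConformalNormalGauss ε x N ↔
      ∀ p, normalGaussMap x N p 2 ^ 2 = 1 + ε * gaussCurvature ε x p := by
  constructor
  · rintro ⟨ρ, -, hρ⟩ p
    obtain ⟨τ, hτ⟩ := hS.fourthForm_eq hε p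
    have hτρ : ρ p = τ := by
      by_contra hne
      have hne' := sub_ne_zero.mpr hne
      -- If `ρ ≠ τ`, comparing the two expressions for `IV` makes `II` a multiple of `I`.
      refine hu p ⟨(normalGaussMap x N p 2 ^ 2 - (1 + ε * gaussCurvature ε x p)) / (ρ p - τ),
        fun v w => ?_⟩
      have h := hτ v w
      rw [hρ] at h
      field_simp
      linear_combination h
    obtain ⟨v, hv⟩ : ∃ v : E 2, v ≠ 0 := exists_ne 0
    have hI : 0 < firstForm ε x p v v := hS.spacelike p v hv
    have h := (hρ p v v).symm.trans (hτ v v)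
    rw [hτρ, right_eq_add] at h
    linarith [(mul_eq_zero.mp h).resolve_right hI.ne']
  · intro hK
    choose τ hτ using fun p => hS.fourthForm_eq hε p
    have hρ : ∀ (p : M) (v w : TangentSpace (𝓡 2) p),
        fourthForm ε x N p v w = τ p * secondForm ε x N p v w := by
      intro p v w
      rw [hτ, hK, sub_self, zero_mul, zero_add]
    refine ⟨τ, contMDiff_of_fourthForm_eq hε hS (fun p => ?_) hρ, hρ⟩
    by_contra! h
    -- A point where `II` vanishes is an umbilic with `c = 0`.
    exact hu p ⟨0, fun v w => (h v w).trans (zero_mul _).symm⟩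

end Surface

end NormalGauss

end

theorem theorem3p3 {M : Type*} [TopologicalSpace M] [ChartedSpace (EuclideanSpace ℝ (Fin 2)) M]
    [IsManifold (𝓡 2) ∞ M] (x N : M → EuclideanSpace ℝ (Fin 3)) :
    (NormalGauss.IsSurface 1 x N → (∀ p, ¬ NormalGauss.IsUmbilic 1 x N p) →
      (NormalGauss.IsConformalNormalGauss 1 x N ↔
        ∀ p, NormalGauss.gaussCurvature 1 x p = -1 + (NormalGauss.normalGaussMap x N p 2) ^ 2)) ∧
    (NormalGauss.IsSurface (-1) x N → (∀ p, ¬ NormalGauss.IsUmbilic (-1) x N p) →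
      (NormalGauss.IsConformalNormalGauss (-1) x N ↔
        ∀ p, NormalGauss.gaussCurvature (-1) x p =
          1 - (NormalGauss.normalGaussMap x N p 2) ^ 2)) := by
  refine ⟨fun hS hu => ?_, fun hS hu => ?_⟩
  · rw [NormalGauss.isConformalNormalGauss_iff (by norm_num) hS hu]
    exact forall_congr' fun p => ⟨fun h => by linarith, fun h => by linarith⟩
  · rw [NormalGauss.isConformalNormalGauss_iff (by norm_num) hS hu]
    exact forall_congr' fun p => ⟨fun h => by linarith, fun h => by linarith⟩
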